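/- Let $d\ge 1$. There exist constants $C_1,C_2,\alpha_1,\alpha_2>0$ depending only on $d$, a sequence of positive numbers $N_j\to\infty$, and a sequence of real-valued Schwartz functions $f_j:\mathbb R^d\to\mathbb R$ with $\int_{\mathbb R^d} f_j^4\,dx>0$ such that, for every $j$, $$-C_2<\frac{\int_{\mathbb R^d}(\Delta^2 f_j)\,f_j^3\,dx}{N_j^4\int_{\mathbb R^d}f_j^4\,dx}<-C_1<0,$$ and, with $\widehat f(\xi)=\int_{\mathbb R^d}f(x)e^{-i\xi\cdot x}\,dx$, $$\mathrm{supp}(\widehat{f_j})\subset\{\xi\in\mathbb R^d:\ \alpha_1N_j<|\xi|<\alpha_2N_j\}.$$ Here $\Delta^2=\Delta\circ\Delta$ is the biharmonic operator and $\mathrm{supp}$ denotes the closed support. -/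

import Mathlib

open Filter MeasureTheory
open scoped Topology SchwartzMap

/-- The Fourier transform `f̂(ξ) = ∫ f(x) e^{-i ξ·x} dx` on `ℝ^d` of a real-valued function. -/
noncomputable def fourierHat {d : ℕ} (f : EuclideanSpace ℝ (Fin d) → ℝ)
    (ξ : EuclideanSpace ℝ (Fin d)) : ℂ :=
  ∫ x : EuclideanSpace ℝ (Fin d), (f x : ℂ) * Complex.exp (-(Complex.I * ((inner ℝ ξ x : ℝ) : ℂ)))

/-- The biharmonic operator `Δ² f = Δ (Δ f)` on `ℝ^d`, with `Δ` the usual Laplacian. -/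
noncomputable def biLaplacian {d : ℕ} (f : EuclideanSpace ℝ (Fin d) → ℝ) :
    EuclideanSpace ℝ (Fin d) → ℝ :=
  Laplacian.laplacian (Laplacian.laplacian f)

/-! ### Derivatives of modulated Schwartz functions -/

section modulation

open scoped LineDeriv

variable {V : Type*} [NormedAddCommGroup V] [InnerProductSpace ℝ V]

/-! A pure cosine gives the wrong sign: the mean of `(cos)'''' cos ^ 3` is `3/8`. Subtracting a
small third harmonic, `g = cos θ - ε cos 3θ`, multiplies that harmonic by `81` in the fourth
derivative, and it correlates with `cos ^ 3` because `cos ^ 3 θ` contains `cos 3θ / 4`. The mean of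
`g'''' g ^ 3` becomes `3/8 - 21 ε / 2 + 123 ε ^ 2 / 2 + 243 ε ^ 4 / 8`, which is negative at `ε =
1/12`.

To localize, fix a unit vector `e` and a band-limited real Schwartz function `χ ≠ 0`, and take `f =
g(t ⟪e, x⟫) χ x` with `N = t` large. Derivatives falling on `χ` cost a factor `t` each, so `Δ² f = t
^ 4 g''''(t ⟪e, x⟫) χ + O(t ^ 3)` (`exists_abs_biLaplacian_wavePacket_sub_le`). By Riemann–Lebesgue
the oscillating factors average out (`tendsto_integral_mul_evenTrigPoly`), so the quotient tends to
the ratio of the means of `g'''' g ^ 3` and `g ^ 4`. The spectrum lies in fixed-radius balls around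
`±t e` and `±3 t e`, hence in an annulus of scale `t` (`tsupport_fourierHat_wavePacket_subset`). -/

theorem Real.hasTemperateGrowth_cos : Real.cos.HasTemperateGrowth :=
  ⟨Real.contDiff_cos, fun n ↦ ⟨0, 1, fun x ↦ by
    simpa [norm_iteratedFDeriv_eq_norm_iteratedDeriv] using Real.abs_iteratedDeriv_cos_le_one n x⟩⟩

theorem Real.hasTemperateGrowth_sin : Real.sin.HasTemperateGrowth :=
  ⟨Real.contDiff_sin, fun n ↦ ⟨0, 1, fun x ↦ by
    simpa [norm_iteratedFDeriv_eq_norm_iteratedDeriv] using Real.abs_iteratedDeriv_sin_le_one n x⟩⟩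

theorem hasTemperateGrowth_cos_inner (w : V) :
    (fun x : V ↦ Real.cos (inner ℝ w x)).HasTemperateGrowth :=
  Real.hasTemperateGrowth_cos.comp (Function.hasTemperateGrowth_inner_right w)

theorem hasTemperateGrowth_sin_inner (w : V) :
    (fun x : V ↦ Real.sin (inner ℝ w x)).HasTemperateGrowth :=
  Real.hasTemperateGrowth_sin.comp (Function.hasTemperateGrowth_inner_right w)

/-- Multiplication of a Schwartz function by `cos ⟪w, x⟫`. -/
noncomputable def cosMul (w : V) : 𝓢(V, ℝ) →L[ℝ] 𝓢(V, ℝ) :=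
  SchwartzMap.smulLeftCLM ℝ (fun x : V ↦ Real.cos (inner ℝ w x))

/-- Multiplication of a Schwartz function by `sin ⟪w, x⟫`. -/
noncomputable def sinMul (w : V) : 𝓢(V, ℝ) →L[ℝ] 𝓢(V, ℝ) :=
  SchwartzMap.smulLeftCLM ℝ (fun x : V ↦ Real.sin (inner ℝ w x))

@[simp]
theorem cosMul_apply (w : V) (a : 𝓢(V, ℝ)) (x : V) :
    cosMul w a x = Real.cos (inner ℝ w x) * a x :=
  SchwartzMap.smulLeftCLM_apply_apply (hasTemperateGrowth_cos_inner w) a x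

@[simp]
theorem sinMul_apply (w : V) (a : 𝓢(V, ℝ)) (x : V) :
    sinMul w a x = Real.sin (inner ℝ w x) * a x :=
  SchwartzMap.smulLeftCLM_apply_apply (hasTemperateGrowth_sin_inner w) a x

theorem lineDeriv_cosMul (w v : V) (a : 𝓢(V, ℝ)) :
    ∂_{v} (cosMul w a) = cosMul w (∂_{v} a) + (-inner ℝ w v) • sinMul w a := by
  ext x
  have h : HasFDerivAt (cosMul w a : V → ℝ) _ x :=
    (((Real.hasDerivAt_cos _).comp_hasFDerivAt x (innerSL ℝ w).hasFDerivAt).mul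
      (a.hasFDerivAt x)).congr_of_eventuallyEq (.of_forall fun y ↦ by simp)
  rw [SchwartzMap.lineDerivOp_apply_eq_fderiv, h.fderiv]
  simp [SchwartzMap.lineDerivOp_apply_eq_fderiv]
  ring

theorem lineDeriv_sinMul (w v : V) (a : 𝓢(V, ℝ)) :
    ∂_{v} (sinMul w a) = sinMul w (∂_{v} a) + inner ℝ w v • cosMul w a := by
  ext x
  have h : HasFDerivAt (sinMul w a : V → ℝ) _ x :=
    (((Real.hasDerivAt_sin _).comp_hasFDerivAt x (innerSL ℝ w).hasFDerivAt).mul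
      (a.hasFDerivAt x)).congr_of_eventuallyEq (.of_forall fun y ↦ by simp)
  rw [SchwartzMap.lineDerivOp_apply_eq_fderiv, h.fderiv]
  simp [SchwartzMap.lineDerivOp_apply_eq_fderiv]
  ring

/-- Makes the cross term of the Laplacian of a product independent of the basis. -/
theorem sum_inner_smul_lineDeriv {ι : Type*} [Fintype ι] (b : OrthonormalBasis ι ℝ V) (w : V)
    (a : 𝓢(V, ℝ)) : ∑ i, inner ℝ w (b i) • ∂_{b i} a = ∂_{w} a := by
  ext x
  simp only [sum_apply, smul_apply,
    SchwartzMap.lineDerivOp_apply_eq_fderiv]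
  conv_rhs => rw [← b.sum_repr' w]
  simp [real_inner_comm]

theorem SchwartzMap.exists_abs_le (a : 𝓢(V, ℝ)) : ∃ B, 0 ≤ B ∧ ∀ x, |a x| ≤ B :=
  ⟨SchwartzMap.seminorm ℝ 0 0 a, apply_nonneg _ _, a.norm_le_seminorm ℝ⟩

variable [FiniteDimensional ℝ V]

open Laplacian in
theorem laplacian_cosMul (w : V) (a : 𝓢(V, ℝ)) :
    Δ (cosMul w a) = cosMul w (Δ a - ‖w‖ ^ 2 • a) - (2 : ℝ) • sinMul w (∂_{w} a) := by
  set b := stdOrthonormalBasis ℝ V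
  rw [SchwartzMap.laplacian_eq_sum b, SchwartzMap.laplacian_eq_sum b a,
    ← sum_inner_smul_lineDeriv b w a, ← b.sum_sq_inner_left w]
  ext x
  simp only [lineDeriv_cosMul, lineDeriv_sinMul, LineDeriv.lineDerivOp_add,
    LineDeriv.lineDerivOp_smul, sum_apply, sub_apply,
    smul_apply, add_apply, cosMul_apply, sinMul_apply, smul_eq_mul,
    Finset.mul_sum, Finset.sum_mul, mul_sub, ← Finset.sum_sub_distrib]
  refine Finset.sum_congr rfl fun i _ ↦ ?_
  ring

open Laplacian in
theorem laplacian_sinMul (w : V) (a : 𝓢(V, ℝ)) :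
    Δ (sinMul w a) = sinMul w (Δ a - ‖w‖ ^ 2 • a) + (2 : ℝ) • cosMul w (∂_{w} a) := by
  set b := stdOrthonormalBasis ℝ V
  rw [SchwartzMap.laplacian_eq_sum b, SchwartzMap.laplacian_eq_sum b a,
    ← sum_inner_smul_lineDeriv b w a, ← b.sum_sq_inner_left w]
  ext x
  simp only [lineDeriv_cosMul, lineDeriv_sinMul, LineDeriv.lineDerivOp_add,
    LineDeriv.lineDerivOp_smul, sum_apply, sub_apply,
    smul_apply, add_apply, cosMul_apply, sinMul_apply, smul_eq_mul,
    Finset.mul_sum, Finset.sum_mul, mul_sub, ← Finset.sum_sub_distrib, ← Finset.sum_add_distrib]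
  refine Finset.sum_congr rfl fun i _ ↦ ?_
  ring

open Laplacian in
theorem laplacian_laplacian_cosMul (w : V) (a : 𝓢(V, ℝ)) (x : V) :
    Δ (Δ (cosMul w a)) x = ‖w‖ ^ 4 * (Real.cos (inner ℝ w x) * a x)
      + 4 * ‖w‖ ^ 2 * (Real.sin (inner ℝ w x) * (∂_{w} a) x)
      - Real.cos (inner ℝ w x) * (2 * ‖w‖ ^ 2 * Δ a x + 4 * (∂_{w} (∂_{w} a)) x)
      - 2 * Real.sin (inner ℝ w x) * ((Δ (∂_{w} a)) x + (∂_{w} (Δ a)) x)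
      + Real.cos (inner ℝ w x) * Δ (Δ a) x := by
  have hsub (f g : 𝓢(V, ℝ)) : Δ (f - g) = Δ f - Δ g :=
    map_sub (LineDeriv.laplacianCLM ℝ V 𝓢(V, ℝ)) f g
  have hsmul (c : ℝ) (f : 𝓢(V, ℝ)) : Δ (c • f) = c • Δ f :=
    map_smul (LineDeriv.laplacianCLM ℝ V 𝓢(V, ℝ)) c f
  have hdsub (f g : 𝓢(V, ℝ)) : ∂_{w} (f - g) = ∂_{w} f - ∂_{w} g :=
    map_sub (LineDeriv.lineDerivOpCLM ℝ 𝓢(V, ℝ) w) f g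
  simp only [laplacian_cosMul, laplacian_sinMul, hsub, hsmul, hdsub, LineDeriv.lineDerivOp_smul,
    sub_apply, add_apply, smul_apply, cosMul_apply, sinMul_apply, smul_eq_mul]
  ring

open Laplacian in
-- In the expansion of `laplacian_laplacian_cosMul` with `w = t • e`, each term other than the
-- leading one has degree at most `3` in `t`, times a bounded trigonometric factor and a bounded
-- derivative of `a`.
theorem exists_abs_laplacian_laplacian_cosMul_sub_le {e : V} (he : ‖e‖ = 1) (a : 𝓢(V, ℝ)) :
    ∃ B, 0 ≤ B ∧ ∀ t : ℝ, 1 ≤ t → ∀ x,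
      |Δ (Δ (cosMul (t • e) a)) x - t ^ 4 * (Real.cos (t * inner ℝ e x) * a x)| ≤ B * t ^ 3 := by
  obtain ⟨B₁, h₁, H₁⟩ := (∂_{e} a).exists_abs_le
  obtain ⟨B₂, h₂, H₂⟩ := (Δ a).exists_abs_le
  obtain ⟨B₃, h₃, H₃⟩ := (∂_{e} (∂_{e} a)).exists_abs_le
  obtain ⟨B₄, h₄, H₄⟩ := (Δ (∂_{e} a)).exists_abs_le
  obtain ⟨B₅, h₅, H₅⟩ := (∂_{e} (Δ a)).exists_abs_le
  obtain ⟨B₆, h₆, H₆⟩ := (Δ (Δ a)).exists_abs_le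
  refine ⟨4 * B₁ + (2 * B₂ + 4 * B₃) + 2 * (B₄ + B₅) + B₆, by positivity, fun t ht x ↦ ?_⟩
  have hsmul (c : ℝ) (f : 𝓢(V, ℝ)) : Δ (c • f) = c • Δ f :=
    map_smul (LineDeriv.laplacianCLM ℝ V 𝓢(V, ℝ)) c f
  have key : ∀ s u B : ℝ, |s| ≤ 1 → |u| ≤ B → |s * u| ≤ B := fun s u B hs hu ↦ by
    rw [abs_mul]
    nlinarith [abs_nonneg s, abs_nonneg u]
  have hc := Real.abs_cos_le_one (t * inner ℝ e x)
  have hs := Real.abs_sin_le_one (t * inner ℝ e x)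
  have k₁ := abs_le.1 (key _ _ _ hs (H₁ x))
  have k₂ := abs_le.1 (key _ _ _ hc (H₂ x))
  have k₃ := abs_le.1 (key _ _ _ hc (H₃ x))
  have k₄ := abs_le.1 (key _ _ _ hs (H₄ x))
  have k₅ := abs_le.1 (key _ _ _ hs (H₅ x))
  have k₆ := abs_le.1 (key _ _ _ hc (H₆ x))
  simp only [laplacian_laplacian_cosMul, LineDeriv.lineDerivOp_left_smul,
    LineDeriv.lineDerivOp_smul, hsmul, smul_apply, smul_eq_mul, norm_smul, he, mul_one,
    real_inner_smul_left, Real.norm_of_nonneg (zero_le_one.trans ht)]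
  generalize Real.cos (t * inner ℝ e x) = c at *
  generalize Real.sin (t * inner ℝ e x) = s at *
  have t2 : t ^ 2 ≤ t ^ 3 := pow_le_pow_right₀ ht (by norm_num)
  have t1 : t ≤ t ^ 3 := le_self_pow₀ ht (by norm_num)
  have t0 : 1 ≤ t ^ 3 := one_le_pow₀ ht
  have e₁ : |t ^ 3 * (s * (∂_{e} a) x)| ≤ t ^ 3 * B₁ := by
    rw [abs_mul, abs_of_nonneg (by positivity)]; gcongr; exact abs_le.2 k₁
  have e₂ : |t ^ 2 * (c * (Δ a) x)| ≤ t ^ 3 * B₂ := by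
    rw [abs_mul, abs_of_nonneg (by positivity)]; gcongr; exact abs_le.2 k₂
  have e₃ : |t ^ 2 * (c * (∂_{e} (∂_{e} a)) x)| ≤ t ^ 3 * B₃ := by
    rw [abs_mul, abs_of_nonneg (by positivity)]; gcongr; exact abs_le.2 k₃
  have e₄ : |t * (s * (Δ (∂_{e} a)) x)| ≤ t ^ 3 * B₄ := by
    rw [abs_mul, abs_of_nonneg (by positivity)]; gcongr; exact abs_le.2 k₄
  have e₅ : |t * (s * (∂_{e} (Δ a)) x)| ≤ t ^ 3 * B₅ := by
    rw [abs_mul, abs_of_nonneg (by positivity)]; gcongr; exact abs_le.2 k₅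
  have e₆ : |1 * (c * (Δ (Δ a)) x)| ≤ t ^ 3 * B₆ := by
    rw [abs_mul, abs_of_nonneg (by positivity)]; gcongr; exact abs_le.2 k₆
  rw [abs_le] at *
  constructor <;> linarith

end modulation

/-! ### The Riemann–Lebesgue lemma along a direction -/

section RiemannLebesgue

variable {V : Type*} [NormedAddCommGroup V] [InnerProductSpace ℝ V] [FiniteDimensional ℝ V]
  [MeasurableSpace V] [BorelSpace V]

theorem tendsto_integral_mul_cos_inner {e : V} (he : ‖e‖ = 1) {φ : V → ℝ} (hφ : Integrable φ) :
    Tendsto (fun t : ℝ ↦ ∫ x, φ x * Real.cos (t * inner ℝ e x)) atTop (𝓝 0) := by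
  have h := tendsto_integral_exp_inner_smul_cocompact (fun x ↦ (φ x : ℂ))
  -- The factor `2π` compensates for the kernel `exp (-2πi ⟪x, w⟫)` of the Fourier integral.
  have hw : Tendsto (fun t : ℝ ↦ (t / (2 * Real.pi)) • e) atTop (cocompact V) := by
    rw [← Metric.cobounded_eq_cocompact, ← tendsto_norm_atTop_iff_cobounded]
    simp only [norm_smul, he, mul_one]
    exact tendsto_norm_atTop_atTop.comp (tendsto_id.atTop_div_const Real.two_pi_pos)
  have h' := (Complex.continuous_re.tendsto _).comp (h.comp hw)
  rw [Complex.zero_re] at h'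
  refine h'.congr fun t ↦ ?_
  simp only [Function.comp_apply]
  rw [← RCLike.re_eq_complex_re, ← integral_re]
  · refine integral_congr_ae (.of_forall fun x ↦ ?_)
    have : 2 * Real.pi * -(t / (2 * Real.pi) * inner ℝ x e) = -(t * inner ℝ e x) := by
      rw [real_inner_comm]; field_simp
    simp only [real_inner_smul_right, Circle.smul_def, Real.fourierChar_apply, this,
      RCLike.re_eq_complex_re, smul_eq_mul, Complex.re_mul_ofReal, Complex.exp_ofReal_mul_I_re,
      Real.cos_neg]
    ring
  · exact (Real.fourierIntegral_convergent_iff _).2 hφ.ofReal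

end RiemannLebesgue

/-! ### The Fourier transform and a band-limited real function -/

section fourierHat

open scoped FourierTransform

variable {d : ℕ}

theorem fourierHat_eq_fourier (f : EuclideanSpace ℝ (Fin d) → ℝ) (ξ : EuclideanSpace ℝ (Fin d)) :
    fourierHat f ξ = 𝓕 (fun x ↦ (f x : ℂ)) ((2 * Real.pi)⁻¹ • ξ) := by
  rw [fourierHat, Real.fourier_eq]
  refine integral_congr_ae (.of_forall fun x ↦ ?_)
  have : 2 * Real.pi * -((2 * Real.pi)⁻¹ * inner ℝ x ξ) = -inner ℝ ξ x := by
    rw [real_inner_comm]; field_simp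
  simp only [real_inner_smul_right, Circle.smul_def, Real.fourierChar_apply, this, smul_eq_mul]
  rw [mul_comm]
  push_cast
  ring_nf

theorem integrable_mul_exp_inner (f : 𝓢(EuclideanSpace ℝ (Fin d), ℝ))
    (ξ : EuclideanSpace ℝ (Fin d)) :
    Integrable fun x ↦ (f x : ℂ) * Complex.exp (-(Complex.I * ((inner ℝ ξ x : ℝ) : ℂ))) := by
  refine f.integrable.ofReal.mul_bdd (c := 1) (Continuous.aestronglyMeasurable (by fun_prop))
    (.of_forall fun x ↦ ?_)
  simp [Complex.norm_exp]

theorem fourierHat_sub (f g : 𝓢(EuclideanSpace ℝ (Fin d), ℝ)) (ξ : EuclideanSpace ℝ (Fin d)) :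
    fourierHat (f - g : 𝓢(EuclideanSpace ℝ (Fin d), ℝ)) ξ = fourierHat f ξ - fourierHat g ξ := by
  rw [fourierHat, fourierHat, fourierHat,
    ← integral_sub (integrable_mul_exp_inner f ξ) (integrable_mul_exp_inner g ξ)]
  simp [sub_mul]

theorem fourierHat_smul (c : ℝ) (f : 𝓢(EuclideanSpace ℝ (Fin d), ℝ))
    (ξ : EuclideanSpace ℝ (Fin d)) :
    fourierHat (c • f : 𝓢(EuclideanSpace ℝ (Fin d), ℝ)) ξ = c * fourierHat f ξ := by
  rw [fourierHat, fourierHat, ← integral_const_mul]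
  simp [mul_assoc]

theorem fourierHat_cosMul (w : EuclideanSpace ℝ (Fin d)) (f : 𝓢(EuclideanSpace ℝ (Fin d), ℝ))
    (ξ : EuclideanSpace ℝ (Fin d)) :
    fourierHat (cosMul w f) ξ = (fourierHat f (ξ - w) + fourierHat f (ξ + w)) / 2 := by
  rw [fourierHat, fourierHat, fourierHat, ← integral_add (integrable_mul_exp_inner f _)
    (integrable_mul_exp_inner f _), ← integral_div]
  refine integral_congr_ae (.of_forall fun x ↦ ?_)
  simp only [cosMul_apply, inner_sub_left, inner_add_left]
  push_cast
  rw [Complex.cos, show -(Complex.I * ((inner ℝ ξ x : ℂ) - inner ℝ w x))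
    = -(Complex.I * inner ℝ ξ x) + inner ℝ w x * Complex.I by ring,
    show -(Complex.I * ((inner ℝ ξ x : ℂ) + inner ℝ w x))
    = -(Complex.I * inner ℝ ξ x) + -inner ℝ w x * Complex.I by ring, Complex.exp_add,
    Complex.exp_add]
  ring

/-- Conjugation flips the sign in the kernel, and the substitution `y ↦ -y` flips it back. -/
theorem fourierInv_conj_of_even {φ : EuclideanSpace ℝ (Fin d) → ℝ} (hφ : ∀ x, φ (-x) = φ x)
    (x : EuclideanSpace ℝ (Fin d)) :
    (starRingEnd ℂ) (𝓕⁻ (fun y ↦ (φ y : ℂ)) x) = 𝓕⁻ (fun y ↦ (φ y : ℂ)) x := by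
  rw [Real.fourierInv_eq, ← integral_conj, ← integral_neg_eq_self]
  refine integral_congr_ae (.of_forall fun y ↦ ?_)
  simp [Circle.smul_def, hφ, Real.fourierChar_apply, ← Complex.exp_conj,
    Complex.conj_ofNat]

/-- The inverse transform of an even real bump is real and band-limited. -/
theorem exists_schwartz_fourierHat_eq_zero (d : ℕ) :
    ∃ (χ : 𝓢(EuclideanSpace ℝ (Fin d), ℝ)) (R : ℝ), 0 < R ∧
      (∀ ξ, R < ‖ξ‖ → fourierHat χ ξ = 0) ∧ ∃ x, χ x ≠ 0 := by
  let ψ : ContDiffBump (0 : EuclideanSpace ℝ (Fin d)) := ⟨1, 2, one_pos, one_lt_two⟩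
  have hcs : HasCompactSupport fun x ↦ (ψ x : ℂ) :=
    ψ.hasCompactSupport.comp_left Complex.ofReal_zero
  let Φ : 𝓢(EuclideanSpace ℝ (Fin d), ℂ) :=
    hcs.toSchwartzMap (Complex.ofRealCLM.contDiff.comp ψ.contDiff)
  have hΦ : ⇑Φ = fun x ↦ (ψ x : ℂ) := rfl
  let Ψ := 𝓕⁻ Φ
  let χ := SchwartzMap.postcompCLM (𝕜 := ℝ) Complex.reCLM Ψ
  have hχ : (fun x ↦ (χ x : ℂ)) = Ψ := by
    funext x
    have h : (starRingEnd ℂ) (Ψ x) = Ψ x := by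
      rw [show Ψ x = 𝓕⁻ (⇑Φ) x from congrFun (SchwartzMap.fourierInv_coe Φ) x, hΦ]
      exact fourierInv_conj_of_even ψ.neg x
    simpa [χ] using Complex.conj_eq_iff_re.1 h
  have hhat (ξ) : fourierHat χ ξ = ψ ((2 * Real.pi)⁻¹ • ξ) := by
    rw [fourierHat_eq_fourier, hχ, ← SchwartzMap.fourier_coe, FourierTransform.fourier_fourierInv_eq Φ, hΦ]
  -- The bump has outer radius `2`, which the rescaling by `2π` turns into `4π`.
  refine ⟨χ, 4 * Real.pi, by positivity, fun ξ hξ ↦ ?_, ?_⟩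
  · rw [hhat, ψ.zero_of_le_dist, Complex.ofReal_zero]
    rw [dist_zero_right, norm_smul, Real.norm_of_nonneg (by positivity)]
    change 2 ≤ _
    field_simp
    linarith
  -- If `χ` vanished identically, so would its transform, whose value at `0` is `1`.
  · by_contra! h
    have h0 := hhat 0
    rw [smul_zero, ψ.one_of_mem_closedBall (by simp [ψ.rIn_pos.le])] at h0
    simp [fourierHat, h] at h0

end fourierHat

/-! ### The trigonometric profile and its averages -/

section trig

/-- The one-dimensional profile, whose fourth derivative correlates negatively with its cube. -/
noncomputable def trigProfile (θ : ℝ) : ℝ := Real.cos θ - 1 / 12 * Real.cos (3 * θ)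

/-- The fourth derivative of `trigProfile`. -/
noncomputable def trigProfileDeriv4 (θ : ℝ) : ℝ := Real.cos θ - 81 / 12 * Real.cos (3 * θ)

theorem abs_trigProfile_le (θ : ℝ) : |trigProfile θ| ≤ 2 := by
  have h₁ := abs_le.1 (Real.abs_cos_le_one θ)
  have h₂ := abs_le.1 (Real.abs_cos_le_one (3 * θ))
  rw [trigProfile, abs_le]
  constructor <;> linarith

theorem abs_trigProfileDeriv4_le (θ : ℝ) : |trigProfileDeriv4 θ| ≤ 8 := by
  have h₁ := abs_le.1 (Real.abs_cos_le_one θ)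
  have h₂ := abs_le.1 (Real.abs_cos_le_one (3 * θ))
  rw [trigProfileDeriv4, abs_le]
  constructor <;> linarith

theorem continuous_trigProfile : Continuous trigProfile := by
  unfold trigProfile; fun_prop

theorem continuous_trigProfileDeriv4 : Continuous trigProfileDeriv4 := by
  unfold trigProfileDeriv4; fun_prop

theorem cos_four_mul (θ : ℝ) : Real.cos (4 * θ) = 8 * Real.cos θ ^ 4 - 8 * Real.cos θ ^ 2 + 1 := by
  rw [show 4 * θ = 2 * (2 * θ) by ring, Real.cos_two_mul, Real.cos_two_mul]; ring

theorem cos_six_mul (θ : ℝ) : Real.cos (6 * θ) =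
    32 * Real.cos θ ^ 6 - 48 * Real.cos θ ^ 4 + 18 * Real.cos θ ^ 2 - 1 := by
  rw [show 6 * θ = 2 * (3 * θ) by ring, Real.cos_two_mul, Real.cos_three_mul]; ring

theorem cos_eight_mul (θ : ℝ) : Real.cos (8 * θ) =
    2 * (8 * Real.cos θ ^ 4 - 8 * Real.cos θ ^ 2 + 1) ^ 2 - 1 := by
  rw [show 8 * θ = 2 * (4 * θ) by ring, Real.cos_two_mul, cos_four_mul]

theorem cos_ten_mul (θ : ℝ) : Real.cos (10 * θ) =
    2 * (8 * Real.cos θ ^ 4 - 8 * Real.cos θ ^ 2 + 1) *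
      (32 * Real.cos θ ^ 6 - 48 * Real.cos θ ^ 4 + 18 * Real.cos θ ^ 2 - 1)
      - (2 * Real.cos θ ^ 2 - 1) := by
  rw [← cos_four_mul, ← cos_six_mul, ← Real.cos_two_mul]
  have h₁ := Real.cos_add (6 * θ) (4 * θ)
  have h₂ := Real.cos_sub (6 * θ) (4 * θ)
  rw [show 6 * θ + 4 * θ = 10 * θ by ring] at h₁
  rw [show 6 * θ - 4 * θ = 2 * θ by ring] at h₂
  linarith

theorem cos_twelve_mul (θ : ℝ) : Real.cos (12 * θ) =
    2 * (32 * Real.cos θ ^ 6 - 48 * Real.cos θ ^ 4 + 18 * Real.cos θ ^ 2 - 1) ^ 2 - 1 := by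
  rw [show 12 * θ = 2 * (6 * θ) by ring, Real.cos_two_mul, cos_six_mul]

/-- The even trigonometric polynomial with constant term `c₀` and `2 (k + 1)`-th coefficient
`c k`. -/
noncomputable def evenTrigPoly (c₀ : ℝ) {n : ℕ} (c : Fin n → ℝ) (θ : ℝ) : ℝ :=
  c₀ + ∑ k, c k * Real.cos (2 * ((k : ℝ) + 1) * θ)

theorem evenTrigPoly_six (c₀ c₁ c₂ c₃ c₄ c₅ c₆ θ : ℝ) :
    evenTrigPoly c₀ ![c₁, c₂, c₃, c₄, c₅, c₆] θ =
      c₀ + c₁ * Real.cos (2 * θ) + c₂ * Real.cos (4 * θ) + c₃ * Real.cos (6 * θ)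
        + c₄ * Real.cos (8 * θ) + c₅ * Real.cos (10 * θ) + c₆ * Real.cos (12 * θ) := by
  simp [evenTrigPoly, Fin.sum_univ_succ]
  norm_num
  ring

/-- A product of four odd harmonics of order at most `3` has only even harmonics up to `12`. The
constant term is the mean; the other coefficients do not affect the limit. Expressing everything in
powers of `cos θ` reduces the identity to one between polynomials. -/
theorem trigProfile_pow_four (θ : ℝ) :
    trigProfile θ ^ 4 = evenTrigPoly (19009 / 55296)
      ![443 / 1152, 5 / 1152, -1295 / 41472, 17 / 3456, -1 / 3456, 1 / 165888] θ := by
  rw [evenTrigPoly_six, cos_four_mul, cos_six_mul, cos_eight_mul, cos_ten_mul, cos_twelve_mul,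
    trigProfile, Real.cos_two_mul, Real.cos_three_mul]
  ring

/-- The negative constant term `-439 / 6144` is the source of the sign in the theorem. -/
theorem trigProfileDeriv4_mul_trigProfile_pow_three (θ : ℝ) :
    trigProfileDeriv4 θ * trigProfile θ ^ 3 = evenTrigPoly (-439 / 6144)
      ![-2017 / 1152, -2695 / 1152, -685 / 1536, 677 / 3456, -61 / 3456, 1 / 2048] θ := by
  rw [evenTrigPoly_six, cos_four_mul, cos_six_mul, cos_eight_mul, cos_ten_mul, cos_twelve_mul,
    trigProfile, trigProfileDeriv4, Real.cos_two_mul, Real.cos_three_mul]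
  ring

/-- Every nonconstant harmonic has frequency tending to infinity with `t`, so only the constant term
survives. -/
theorem tendsto_integral_mul_evenTrigPoly {V : Type*} [NormedAddCommGroup V]
    [InnerProductSpace ℝ V] [FiniteDimensional ℝ V] [MeasurableSpace V] [BorelSpace V]
    {e : V} (he : ‖e‖ = 1) {φ : V → ℝ} (hφ : Integrable φ) (c₀ : ℝ) {n : ℕ} (c : Fin n → ℝ) :
    Tendsto (fun t : ℝ ↦ ∫ x, φ x * evenTrigPoly c₀ c (t * inner ℝ e x)) atTop
      (𝓝 (c₀ * ∫ x, φ x)) := by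
  have hint (s : ℝ) : Integrable fun x ↦ φ x * Real.cos (s * inner ℝ e x) :=
    hφ.mul_bdd (c := 1) (Continuous.aestronglyMeasurable (by fun_prop))
      (.of_forall fun x ↦ Real.abs_cos_le_one _)
  have key (t : ℝ) : ∫ x, φ x * evenTrigPoly c₀ c (t * inner ℝ e x) =
      c₀ * (∫ x, φ x) +
        ∑ k, c k * ∫ x, φ x * Real.cos (2 * ((k : ℝ) + 1) * t * inner ℝ e x) := by
    simp_rw [← integral_const_mul]
    rw [← integral_finsetSum _ fun k _ ↦ (hint _).const_mul _, ← integral_add (hφ.const_mul _)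
      (integrable_finsetSum _ fun k _ ↦ (hint _).const_mul _)]
    refine integral_congr_ae (.of_forall fun x ↦ ?_)
    simp only [evenTrigPoly, mul_add, Finset.mul_sum]
    congr 1
    · ring
    · refine Finset.sum_congr rfl fun k _ ↦ ?_
      ring_nf
  simp_rw [key]
  have hlim (k : Fin n) := ((tendsto_integral_mul_cos_inner he hφ).comp
    (tendsto_id.const_mul_atTop (show 0 < 2 * ((k : ℝ) + 1) by positivity))).const_mul (c k)
  simpa using (tendsto_finsetSum Finset.univ fun k _ ↦ hlim k).const_add (c₀ * ∫ x, φ x)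

end trig

/-! ### Wave packets: spectrum and asymptotics of the integrals -/

section wavePacket

variable {d : ℕ}

/-- The Schwartz function `x ↦ trigProfile (t ⟪e, x⟫) χ x`. -/
noncomputable def wavePacket (χ : 𝓢(EuclideanSpace ℝ (Fin d), ℝ)) (e : EuclideanSpace ℝ (Fin d))
    (t : ℝ) : 𝓢(EuclideanSpace ℝ (Fin d), ℝ) :=
  cosMul (t • e) χ - (1 / 12 : ℝ) • cosMul ((3 * t) • e) χ

variable (χ : 𝓢(EuclideanSpace ℝ (Fin d), ℝ)) (e : EuclideanSpace ℝ (Fin d))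

theorem wavePacket_apply (t : ℝ) (x : EuclideanSpace ℝ (Fin d)) :
    wavePacket χ e t x = trigProfile (t * inner ℝ e x) * χ x := by
  simp only [wavePacket, sub_apply, smul_apply, cosMul_apply, real_inner_smul_left, trigProfile,
    smul_eq_mul]
  ring_nf

/-- Since `R < t / 2`, the balls of radius `R` around `±t e` and `±3 t e` stay within `t / 2 ≤ ‖ξ‖ ≤
7 t / 2`. -/
theorem fourierHat_wavePacket_eq_zero {e : EuclideanSpace ℝ (Fin d)} (he : ‖e‖ = 1) {R : ℝ}
    (hχ : ∀ ξ, R < ‖ξ‖ → fourierHat χ ξ = 0) {t : ℝ} (ht : 2 * R < t) (ht0 : 0 < t)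
    {ξ : EuclideanSpace ℝ (Fin d)} (hξ : ‖ξ‖ < 1 / 2 * t ∨ 7 / 2 * t < ‖ξ‖) :
    fourierHat (wavePacket χ e t) ξ = 0 := by
  have hzero (s : ℝ) (hs : R < |‖ξ‖ - s|) (hs0 : 0 ≤ s) :
      fourierHat (cosMul (s • e) χ) ξ = 0 := by
    have hn : ‖s • e‖ = s := by rw [norm_smul, he, mul_one, Real.norm_of_nonneg hs0]
    rw [fourierHat_cosMul, hχ, hχ, add_zero, zero_div]
    · have := abs_norm_sub_norm_le ξ (-(s • e))
      rw [norm_neg, hn, sub_neg_eq_add] at this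
      exact hs.trans_le this
    · have := abs_norm_sub_norm_le ξ (s • e)
      rw [hn] at this
      exact hs.trans_le this
  rw [wavePacket, fourierHat_sub, fourierHat_smul, hzero t, hzero (3 * t), mul_zero, sub_zero]
  · rw [lt_abs]
    rcases hξ with h | h
    · right; linarith
    · left; linarith
  · positivity
  · rw [lt_abs]
    rcases hξ with h | h
    · right; linarith
    · left; linarith
  · positivity

theorem tsupport_fourierHat_wavePacket_subset {e : EuclideanSpace ℝ (Fin d)} (he : ‖e‖ = 1) {R : ℝ}
    (hχ : ∀ ξ, R < ‖ξ‖ → fourierHat χ ξ = 0) {t : ℝ} (ht : 2 * R < t) (ht0 : 0 < t) :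
    tsupport (fourierHat (wavePacket χ e t)) ⊆
      {ξ : EuclideanSpace ℝ (Fin d) | 1 / 4 * t < ‖ξ‖ ∧ ‖ξ‖ < 4 * t} := by
  -- The closed annulus absorbs the closure in the support; the open one with `1/4` and `4` leaves
  -- room for strict inequalities.
  have hsub : tsupport (fourierHat (wavePacket χ e t)) ⊆
      {ξ : EuclideanSpace ℝ (Fin d) | 1 / 2 * t ≤ ‖ξ‖ ∧ ‖ξ‖ ≤ 7 / 2 * t} := by
    refine closure_minimal (fun ξ hξ ↦ ?_) ?_
    · by_contra hc
      refine hξ (fourierHat_wavePacket_eq_zero χ he hχ ht ht0 ?_)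
      rw [Set.mem_ofPred_eq, not_and_or, not_le, not_le] at hc
      exact hc
    · exact (isClosed_le continuous_const continuous_norm).inter
        (isClosed_le continuous_norm continuous_const)
  refine hsub.trans fun ξ hξ ↦ ⟨?_, ?_⟩
  · linarith [hξ.1]
  · linarith [hξ.2]

theorem integrable_schwartz_mul (a : 𝓢(EuclideanSpace ℝ (Fin d), ℝ))
    {g : EuclideanSpace ℝ (Fin d) → ℝ} (hg : Continuous g) {B : ℝ} (hB : ∀ x, |g x| ≤ B) :
    Integrable fun x ↦ a x * g x :=
  a.integrable.mul_bdd hg.aestronglyMeasurable (.of_forall hB)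

theorem integrable_schwartz_mul_pow (a b : 𝓢(EuclideanSpace ℝ (Fin d), ℝ)) (n : ℕ) :
    Integrable fun x ↦ a x * b x ^ n := by
  obtain ⟨B, hB0, hB⟩ := b.exists_abs_le
  refine integrable_schwartz_mul a (b.continuous.pow n) (B := B ^ n) fun x ↦ ?_
  rw [abs_pow]
  exact pow_le_pow_left₀ (abs_nonneg _) (hB x) n

theorem tendsto_integral_wavePacket_pow_four {e : EuclideanSpace ℝ (Fin d)} (he : ‖e‖ = 1) :
    Tendsto (fun t ↦ ∫ x, wavePacket χ e t x ^ 4) atTop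
      (𝓝 (19009 / 55296 * ∫ x, χ x ^ 4)) := by
  have hχ : Integrable fun x ↦ χ x ^ 4 := by
    simpa [← pow_succ'] using integrable_schwartz_mul_pow χ χ 3
  refine (tendsto_integral_mul_evenTrigPoly he hχ _
    ![443 / 1152, 5 / 1152, -1295 / 41472, 17 / 3456, -1 / 3456, 1 / 165888]).congr fun t ↦ ?_
  simp_rw [← trigProfile_pow_four, wavePacket_apply, mul_pow, mul_comm]

open Laplacian in
theorem biLaplacian_eq_laplacian_laplacian (f : 𝓢(EuclideanSpace ℝ (Fin d), ℝ)) :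
    biLaplacian f = Δ (Δ f) := by
  have h (g : 𝓢(EuclideanSpace ℝ (Fin d), ℝ)) :
      Laplacian.laplacian (g : EuclideanSpace ℝ (Fin d) → ℝ) = Δ g :=
    funext fun x ↦ (SchwartzMap.laplacian_apply g x).symm
  rw [biLaplacian, h, h]

theorem exists_abs_biLaplacian_wavePacket_sub_le {e : EuclideanSpace ℝ (Fin d)} (he : ‖e‖ = 1) :
    ∃ B, 0 ≤ B ∧ ∀ t : ℝ, 1 ≤ t → ∀ x,
      |biLaplacian (wavePacket χ e t) x - t ^ 4 * (χ x * trigProfileDeriv4 (t * inner ℝ e x))|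
        ≤ B * t ^ 3 := by
  obtain ⟨B, hB0, hB⟩ := exists_abs_laplacian_laplacian_cosMul_sub_le he χ
  -- The two frequencies `t` and `3 t` contribute `B + 27 B / 12 ≤ 4 B`.
  refine ⟨4 * B, by positivity, fun t ht x ↦ ?_⟩
  have hsub (f g : 𝓢(EuclideanSpace ℝ (Fin d), ℝ)) :
      Laplacian.laplacian (f - g) = Laplacian.laplacian f - Laplacian.laplacian g :=
    map_sub (LineDeriv.laplacianCLM ℝ _ 𝓢(EuclideanSpace ℝ (Fin d), ℝ)) f g
  have hsmul (c : ℝ) (f : 𝓢(EuclideanSpace ℝ (Fin d), ℝ)) :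
      Laplacian.laplacian (c • f) = c • Laplacian.laplacian f :=
    map_smul (LineDeriv.laplacianCLM ℝ _ 𝓢(EuclideanSpace ℝ (Fin d), ℝ)) c f
  have h₁ := abs_le.1 (hB t ht x)
  have h₂ := abs_le.1 (hB (3 * t) (by linarith) x)
  rw [biLaplacian_eq_laplacian_laplacian, wavePacket, hsub, hsub, hsmul, hsmul, sub_apply,
    smul_apply, trigProfileDeriv4, abs_le, smul_eq_mul, ← mul_assoc 3 t]
  have : 0 ≤ B * t ^ 3 := by positivity
  rw [mul_pow, mul_pow] at h₂
  constructor <;> linarith [h₁.1, h₁.2, h₂.1, h₂.2]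

/-- The `O(t ^ 3)` remainder is integrated against a cube bounded by `8 |χ| ^ 3`, so after division
by `t ^ 4` it is `O(1 / t)`. -/
theorem tendsto_integral_biLaplacian_wavePacket {e : EuclideanSpace ℝ (Fin d)} (he : ‖e‖ = 1) :
    Tendsto (fun t ↦ (∫ x, biLaplacian (wavePacket χ e t) x * wavePacket χ e t x ^ 3) / t ^ 4)
      atTop (𝓝 (-439 / 6144 * ∫ x, χ x ^ 4)) := by
  have hχ : Integrable fun x ↦ χ x ^ 4 := by
    simpa [← pow_succ'] using integrable_schwartz_mul_pow χ χ 3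
  have hχ3 : Integrable fun x ↦ |χ x| ^ 3 := by
    simpa [← pow_succ', abs_mul, abs_pow] using (integrable_schwartz_mul_pow χ χ 2).abs
  have hmain := tendsto_integral_mul_evenTrigPoly he hχ (-439 / 6144)
    ![-2017 / 1152, -2695 / 1152, -685 / 1536, 677 / 3456, -61 / 3456, 1 / 2048]
  simp_rw [← trigProfileDeriv4_mul_trigProfile_pow_three] at hmain
  obtain ⟨B, hB0, hB⟩ := exists_abs_biLaplacian_wavePacket_sub_le χ he
  have herr : Tendsto (fun t : ℝ ↦ (B * 8 * ∫ x, |χ x| ^ 3) / t) atTop (𝓝 0) :=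
    tendsto_const_nhds.div_atTop tendsto_id
  refine hmain.congr_dist (squeeze_zero' (.of_forall fun t ↦ dist_nonneg)
    ?_ herr)
  filter_upwards [eventually_ge_atTop 1] with t ht
  have ht0 : 0 < t := by linarith
  have hbi : Integrable fun x ↦
      biLaplacian (wavePacket χ e t) x * wavePacket χ e t x ^ 3 := by
    rw [biLaplacian_eq_laplacian_laplacian]
    exact integrable_schwartz_mul_pow _ _ 3
  have hprof : Integrable fun x ↦ t ^ 4 * (χ x ^ 4 *
      (trigProfileDeriv4 (t * inner ℝ e x) * trigProfile (t * inner ℝ e x) ^ 3)) := by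
    refine (hχ.mul_bdd (c := 8 * 2 ^ 3) (Continuous.aestronglyMeasurable ?_)
      (.of_forall fun x ↦ ?_)).const_mul _
    · exact (continuous_trigProfileDeriv4.comp (by fun_prop)).mul
        ((continuous_trigProfile.comp (by fun_prop)).pow 3)
    · rw [Real.norm_eq_abs, abs_mul, abs_pow]
      gcongr
      · exact abs_trigProfileDeriv4_le _
      · exact abs_trigProfile_le _
  rw [dist_comm, Real.dist_eq, div_sub' (by positivity), ← integral_const_mul,
    ← integral_sub hbi hprof, abs_div, abs_of_pos (pow_pos ht0 4),
    div_le_div_iff₀ (by positivity) ht0]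
  have hle : |∫ x, (biLaplacian (wavePacket χ e t) x * wavePacket χ e t x ^ 3 -
      t ^ 4 * (χ x ^ 4 *
        (trigProfileDeriv4 (t * inner ℝ e x) * trigProfile (t * inner ℝ e x) ^ 3)))| ≤
      ∫ x, t ^ 3 * (B * 8) * |χ x| ^ 3 := by
    rw [← Real.norm_eq_abs]
    refine norm_integral_le_of_norm_le (hχ3.const_mul _) (.of_forall fun x ↦ ?_)
    have hx := hB t ht x
    have hp := abs_trigProfile_le (t * inner ℝ e x)
    rw [wavePacket_apply, Real.norm_eq_abs, show ∀ u g h c : ℝ,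
      u * (g * c) ^ 3 - t ^ 4 * (c ^ 4 * (h * g ^ 3)) = (u - t ^ 4 * (c * h)) * (g ^ 3 * c ^ 3)
      from fun u g h c ↦ by ring, abs_mul, abs_mul, abs_pow, abs_pow]
    calc _ ≤ B * t ^ 3 * (2 ^ 3 * |χ x| ^ 3) := by gcongr
      _ = _ := by ring
  rw [integral_const_mul] at hle
  calc _ ≤ (t ^ 3 * (B * 8) * ∫ x, |χ x| ^ 3) * t := by gcongr
    _ = _ := by ring

end wavePacket

/-! ### Choice of the sequence -/

theorem theorem2p2 (d : ℕ) (hd : 1 ≤ d) :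
    ∃ C₁ C₂ α₁ α₂ : ℝ, 0 < C₁ ∧ 0 < C₂ ∧ 0 < α₁ ∧ 0 < α₂ ∧
      ∃ (N : ℕ → ℝ) (f : ℕ → 𝓢(EuclideanSpace ℝ (Fin d), ℝ)),
        (∀ j, 0 < N j) ∧ Tendsto N atTop atTop ∧
        ∀ j : ℕ,
          tsupport (fourierHat (f j)) ⊆
            {ξ : EuclideanSpace ℝ (Fin d) | α₁ * N j < ‖ξ‖ ∧ ‖ξ‖ < α₂ * N j} ∧
          0 < ∫ x, f j x ^ 4 ∧
          -C₂ < (∫ x, biLaplacian (f j) x * f j x ^ 3) / (N j ^ 4 * ∫ x, f j x ^ 4) ∧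
          (∫ x, biLaplacian (f j) x * f j x ^ 3) / (N j ^ 4 * ∫ x, f j x ^ 4) < -C₁ := by
  obtain ⟨χ, R, hR, hχ, x₀, hx₀⟩ := exists_schwartz_fourierHat_eq_zero d
  let e : EuclideanSpace ℝ (Fin d) := EuclideanSpace.single ⟨0, hd⟩ 1
  have he : ‖e‖ = 1 := by simp [e]
  have hA : 0 < ∫ x, χ x ^ 4 := by
    have hint : Integrable fun x ↦ χ x ^ 4 := by
      simpa [← pow_succ'] using integrable_schwartz_mul_pow χ χ 3
    exact integral_pos_of_integrable_nonneg_nonzero (x := x₀) (χ.continuous.pow 4) hint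
      (fun x ↦ by positivity) (pow_ne_zero 4 hx₀)
  have h4 := tendsto_integral_wavePacket_pow_four χ he
  -- The limit is `(-439 / 6144) / (19009 / 55296)`, about `-0.21`; the factor `∫ χ ^ 4` cancels.
  -- The bounds `-1` and `-1 / 10` below merely bracket it.
  have hratio : Tendsto (fun t ↦ (∫ x, biLaplacian (wavePacket χ e t) x * wavePacket χ e t x ^ 3) /
      (t ^ 4 * ∫ x, wavePacket χ e t x ^ 4)) atTop (𝓝 (-3951 / 19009)) := by
    have h := (tendsto_integral_biLaplacian_wavePacket χ he).div h4 (by positivity)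
    convert h using 2
    · simp only [Pi.div_apply, div_div]
    · field_simp
      norm_num
  have hev := ((h4.eventually_const_lt (show 0 < 19009 / 55296 * ∫ x, χ x ^ 4 by positivity)).and
    ((hratio.eventually_const_lt (show (-1 : ℝ) < -3951 / 19009 by norm_num)).and
    (hratio.eventually_lt_const (show -3951 / 19009 < (-(1 / 10) : ℝ) by norm_num)))).and
    (eventually_gt_atTop (2 * R))
  obtain ⟨T, hT⟩ := eventually_atTop.1 hev
  have hN (j : ℕ) := hT (T + j) (by simp)
  have hN0 (j : ℕ) : 0 < T + j := (by positivity : 0 < 2 * R).trans (hN j).2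
  refine ⟨1 / 10, 1, 1 / 4, 4, by norm_num, one_pos, by norm_num, by norm_num, fun j ↦ T + j,
    fun j ↦ wavePacket χ e (T + j), hN0,
    tendsto_atTop_add_const_left _ _ tendsto_natCast_atTop_atTop, fun j ↦ ⟨?_, (hN j).1⟩⟩
  exact tsupport_fourierHat_wavePacket_subset χ he hχ (hN j).2 (hN0 j)
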